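/- Consider the random design regression model $Y_j=f_*(X_j)+\xi_j$, $j=1,\dots,n$ ($n\ge 1$), where $X_1,\dots,X_n$ are i.i.d. with distribution $\Pi$ in a measurable space $S$, the noise variables $\xi_1,\dots,\xi_n$ are i.i.d. $N(0,\sigma^2)$ with $\sigma\ge 0$, and $(\xi_1,\dots,\xi_n)$ is independent of $(X_1,\dots,X_n)$. Let $h_1,\dots,h_N:S\to\mathbb R$, $N\ge 2$, be measurable, and put $f_\lambda:=\sum_{j=1}^N\lambda_jh_j$ and $d(\lambda):=\operatorname{card}\{j:\lambda_j\ne 0\}$ for $\lambda\in\mathbb R^N$. For $\varepsilon\ge 0$ let $$\hat\Lambda_\varepsilon:=\Big\{\lambda\in\mathbb R^N:\max_{1\le k\le N}\Big|n^{-1}\sum_{j=1}^n(f_\lambda(X_j)-Y_j)h_k(X_j)\Big|\le\varepsilon\Big\},$$ and let $\hat\lambda=\hat\lambda^\varepsilon$ be any element of $\operatorname{Argmin}_{\lambda\in\hat\Lambda_\varepsilon}\|\lambda\|_{\ell_1}$ (an arbitrary vector if $\hat\Lambda_\varepsilon=\emptyset$). For an integer $d\ge 0$ let $\delta_d(\Pi)$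 be the infimum of all $\delta>0$ such that $(1-\delta)\|\lambda\|_{\ell_2}\le\|f_\lambda\|_{L_2(\Pi)}\le(1+\delta)\|\lambda\|_{\ell_2}$ for all $\lambda\in\mathbb R^N$ with $d(\lambda)\le d$. There exist absolute constants $\bar\delta\in(0,1)$ and $C,D>0$ with the following property. Suppose that, for $X$ with distribution $\Pi$, the random vector $(h_1(X),\dots,h_N(X))$ has a (possibly degenerate) normal distribution with zero mean, and that $f_*=f_{\lambda^*}$ for some $\lambda^*\in\mathbb R^N$. Let $A\ge 1$ and let $\bar d$ be the largest integer $d\ge 0$ such that $$d\le\frac Ne-1,\qquad \delta_{3d}(\Pi)\le\bar\delta,\qquad C\sqrt{\frac{Ad\log(N/d)}{n}}\le\frac14$$ (where $d\log(N/d):=0$ for $d=0$), assuming that such a $d$ exists; if $\bar d=0$, suppose in addition that $A\log N\le n$. Then, for all $$\varepsilon\ge C\sigma\max_{1\le k\le N}\|h_k\|_{L_2(\Pi)}\sqrt{\frac{A\log N}{n}},$$ the condition $d(\lambda^*)\le\bar d$ implies that, with probability at least $1-N^{-A}$, $$\|\hat\lambda-\lambda^*\|_{\ell_2}\le D\sqrt{d(\lambda^*)}\,\varepsilon.$$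 -/

import Mathlib

open MeasureTheory ProbabilityTheory

noncomputable section

namespace Dantzig

variable {S : Type*} {N n : ℕ}

/-- The linear combination `f_λ = ∑ j, λ j * h j` of the dictionary functions. -/
def dictFun (h : Fin N → S → ℝ) (lam : EuclideanSpace ℝ (Fin N)) (s : S) : ℝ :=
  ∑ j, lam j * h j s

/-- `d(λ)`, the number of non-zero coordinates of `λ`. -/
def sparsity (lam : EuclideanSpace ℝ (Fin N)) : ℕ :=
  (Finset.univ.filter fun j => lam j ≠ 0).card

/-- The `ℓ₁`-norm of `λ` (the norm of `EuclideanSpace` is the `ℓ₂`-norm). -/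
def l1Norm (lam : EuclideanSpace ℝ (Fin N)) : ℝ :=
  ∑ j, |lam j|

/-- The restricted isometry constant `δ_d(Π)` of the dictionary `h`: the infimum of the `δ > 0` with
`(1 - δ) ‖λ‖ ≤ ‖f_λ‖_{L₂(Π)} ≤ (1 + δ) ‖λ‖` for all `λ` with at most `d` non-zero coordinates. -/
def ripConst [MeasurableSpace S] (Pi : Measure S) (h : Fin N → S → ℝ) (d : ℕ) : ℝ :=
  sInf {δ : ℝ | 0 < δ ∧ ∀ lam : EuclideanSpace ℝ (Fin N), sparsity lam ≤ d →
    (1 - δ) * ‖lam‖ ≤ lpNorm (dictFun h lam) 2 Pi ∧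
      lpNorm (dictFun h lam) 2 Pi ≤ (1 + δ) * ‖lam‖}

/-- The constraint set of the Dantzig selector for the data `(x j, y j)`, `j = 1, …, n`. -/
def constraintSet (h : Fin N → S → ℝ) (ε : ℝ) (x : Fin n → S) (y : Fin n → ℝ) :
    Set (EuclideanSpace ℝ (Fin N)) :=
  {lam | ∀ k, |(n : ℝ)⁻¹ * ∑ j, (dictFun h lam (x j) - y j) * h k (x j)| ≤ ε}

/-- `lam` is a Dantzig selector for the data `(x j, y j)`: it has the smallest `ℓ₁`-norm in the
constraint set. If the constraint set is empty, any vector is allowed. -/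
def IsDantzigSelector (h : Fin N → S → ℝ) (ε : ℝ) (x : Fin n → S) (y : Fin n → ℝ)
    (lam : EuclideanSpace ℝ (Fin N)) : Prop :=
  (constraintSet h ε x y).Nonempty →
    lam ∈ constraintSet h ε x y ∧ ∀ μ ∈ constraintSet h ε x y, l1Norm lam ≤ l1Norm μ

/-- The dimensions `d ≤ N / e - 1` with `δ_{3d}(Π) ≤ δbar` and `C √(A d log(N / d) / n) ≤ 1 / 4`.
For `d = 0` the quantity `d log(N / d)` is `0`. -/
def admissibleDims [MeasurableSpace S] (Pi : Measure S) (h : Fin N → S → ℝ) (n : ℕ)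
    (δbar C A : ℝ) : Set ℕ :=
  {d : ℕ | (d : ℝ) ≤ (N : ℝ) / Real.exp 1 - 1 ∧ ripConst Pi h (3 * d) ≤ δbar ∧
    C * √(A * d * Real.log ((N : ℝ) / d) / n) ≤ 1 / 4}

end Dantzig

end

/-!
Put `u = λ̂ - λ*`. If the noise is almost uncorrelated with the dictionary, that is
`|n⁻¹ ∑ ξ j * h k (X j)| ≤ ε` for all `k`, then `λ*` is feasible. Hence `λ̂` is feasible too, all
empirical correlations of `f_u` with the dictionary are at most `2 ε`, and minimality of the
`ℓ₁`-norm of `λ̂` gives the cone condition `‖u‖₁ ≤ 2 √d(λ*) ‖u‖` (`l1Norm_sub_le`). So the empirical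
second moment of `f_u` is at most `2 ε ‖u‖₁ ≤ 4 ε √d(λ*) ‖u‖`, and it remains to bound it from below
by `‖u‖ ^ 2 / 2`.

On `3 d`-sparse vectors, `d = dbar`, the empirical second moment is close to `‖·‖ ^ 2`:
* the population second moment is, by the bound on `δ_{3d}(Π)`;
* for fixed `w` the empirical second moment of the normal variable `f_w` is a rescaled chi-square
  variable, with exponentially small deviation probabilities (`measureReal_abs_average_sq_sub_le`);
* every `3 d`-dimensional coordinate subspace has a net of `5 ^ (3 d)` points, the number of these
  subspaces is `exp (O (d log (N / d)))`, and the sample size dominates this entropy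
  (`exists_sparse_net`, `card_mul_le_exp`).

The lower bound passes from sparse vectors to the cone by Maurey's empirical method: `u` is the mean
of a random `3 d`-sparse vector, and averaging the quadratic form over this vector costs only a small
multiple of `‖u‖₁ ^ 2 / d` (`nonneg_add_of_nonneg_sparse`). This replaces the usual ordering of the
coordinates of `u` by size.

The noise event is handled by a Chernoff bound for the products `ξ j * h k (X j)`, whose moment
generating function is computed conditionally on the design (`measureReal_noise_le`). If `dbar = 0`
then `λ* = 0`, and feasibility of `λ*` alone gives `λ̂ = 0`.

The exceptional sets are estimated in outer measure and enlarged to a measurable set at the end,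
because the design is only almost everywhere measurable.
-/

namespace Dantzig

/-! ### Exponential moments of Gaussian squares and products -/

theorem inv_sqrt_one_sub_le {y : ℝ} (hy : |y| ≤ 1 / 2) :
    (√(1 - y))⁻¹ ≤ Real.exp (y / 2 + y ^ 2) := by
  have h1 : |y| < 1 := by linarith
  have h2 := Real.abs_log_sub_add_sum_range_le h1 1
  simp only [Finset.range_one, Finset.sum_singleton, zero_add, pow_one, Nat.cast_zero,
    div_one] at h2
  have h3 : |y| ^ (1 + 1) / (1 - |y|) ≤ 2 * y ^ 2 := by
    rw [div_le_iff₀ (by linarith), one_add_one_eq_two, sq_abs]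
    nlinarith [sq_nonneg y]
  have h4 := (abs_le.1 (h2.trans h3)).1
  have h5 : 0 < 1 - y := by linarith [le_abs_self y]
  rw [Real.sqrt_eq_rpow, ← Real.rpow_neg h5.le, Real.rpow_def_of_pos h5]
  exact Real.exp_le_exp.2 (by linarith)

/-- The square of a centered normal variable of variance `v` has the moment generating function
`(1 - 2 s v) ^ (-1/2)`. -/
theorem integral_exp_mul_sq_gaussianReal (v : NNReal) {s : ℝ} (hs : |2 * s * v| ≤ 1 / 2) :
    Integrable (fun x => Real.exp (s * x ^ 2)) (gaussianReal 0 v) ∧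
      ∫ x, Real.exp (s * x ^ 2) ∂(gaussianReal 0 v) = (√(1 - 2 * s * v))⁻¹ := by
  rcases eq_or_ne v 0 with rfl | hv
  · simp [gaussianReal_zero_var, integrable_dirac]
  have hv' : (0 : ℝ) < v := by positivity
  have h1 : 0 < 1 - 2 * s * v := by linarith [le_abs_self (2 * s * v)]
  set b : ℝ := (1 - 2 * s * v) / (2 * v) with hb
  have hbpos : 0 < b := by positivity
  have key : ∀ x : ℝ, gaussianPDFReal 0 v x * Real.exp (s * x ^ 2) =
      (√(2 * Real.pi * v))⁻¹ * Real.exp (-b * x ^ 2) := by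
    intro x
    rw [gaussianPDFReal, mul_assoc, ← Real.exp_add, hb]
    congr 2
    field_simp
    ring
  constructor
  · rw [gaussianReal_of_var_ne_zero _ hv, integrable_withDensity_iff_integrable_smul'
      (measurable_gaussianPDF _ _) (ae_of_all _ fun _ => gaussianPDF_lt_top)]
    simp only [toReal_gaussianPDF, smul_eq_mul, key]
    exact (integrable_exp_neg_mul_sq hbpos).const_mul _
  · rw [integral_gaussianReal_eq_integral_smul hv]
    simp only [smul_eq_mul, key]
    rw [integral_const_mul, integral_gaussian, ← Real.sqrt_inv, ← Real.sqrt_inv,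
      ← Real.sqrt_mul (by positivity), hb]
    congr 1
    field_simp

theorem integral_exp_mul_gaussianReal (w : NNReal) (a : ℝ) :
    Integrable (fun y => Real.exp (a * y)) (gaussianReal 0 w) ∧
      ∫ y, Real.exp (a * y) ∂(gaussianReal 0 w) = Real.exp (w * a ^ 2 / 2) := by
  refine ⟨integrable_exp_mul_gaussianReal a, ?_⟩
  have := congrFun (mgf_fun_id_gaussianReal (μ := 0) (v := w)) a
  simpa [mgf] using this

/-- The product of two independent centered normal variables is sub-exponential: conditionally on
the first one it is normal, and the conditional moment generating function is the exponential of a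
Gaussian square. -/
theorem integral_exp_mul_mul_gaussianReal_prod (v w : NNReal) {s : ℝ}
    (hs : s ^ 2 * w * v ≤ 1 / 2) :
    Integrable (fun p : ℝ × ℝ => Real.exp (s * (p.1 * p.2)))
        ((gaussianReal 0 v).prod (gaussianReal 0 w)) ∧
      ∫ p : ℝ × ℝ, Real.exp (s * (p.1 * p.2)) ∂((gaussianReal 0 v).prod (gaussianReal 0 w)) ≤
        Real.exp (s ^ 2 * w * v) := by
  set q : ℝ := s ^ 2 * w * v with hq
  have hq0 : 0 ≤ q := by positivity
  have hqv : 2 * (w * s ^ 2 / 2) * v = q := by rw [hq]; ring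
  have hsq := integral_exp_mul_sq_gaussianReal v (s := w * s ^ 2 / 2)
    (by rw [hqv, abs_of_nonneg hq0]; exact hs)
  have hin : ∀ x : ℝ, Integrable (fun y => Real.exp (s * (x * y))) (gaussianReal 0 w) ∧
      ∫ y, Real.exp (s * (x * y)) ∂(gaussianReal 0 w) =
        Real.exp (w * s ^ 2 / 2 * x ^ 2) := by
    intro x
    have h := integral_exp_mul_gaussianReal w (s * x)
    simp only [mul_assoc] at h ⊢
    refine ⟨h.1, h.2.trans ?_⟩
    congr 1; ring
  have hint : Integrable (fun p : ℝ × ℝ => Real.exp (s * (p.1 * p.2)))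
      ((gaussianReal 0 v).prod (gaussianReal 0 w)) := by
    rw [integrable_prod_iff (by fun_prop)]
    refine ⟨ae_of_all _ fun x => (hin x).1, ?_⟩
    simp only [Real.norm_eq_abs, Real.abs_exp, (hin _).2]
    exact hsq.1
  refine ⟨hint, ?_⟩
  rw [integral_prod _ hint]
  simp only [(hin _).2]
  rw [hsq.2, hqv]
  refine (inv_sqrt_one_sub_le (by rw [abs_of_nonneg hq0]; exact hs)).trans ?_
  exact Real.exp_le_exp.2 (by nlinarith)

/-! ### Chernoff bounds for averages of independent variables -/

section Chernoff

variable {Ω : Type*} [MeasurableSpace Ω] {P : Measure Ω} [IsProbabilityMeasure P]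
  {S : Type*} [MeasurableSpace S] {Pi : Measure S} {n : ℕ}

theorem measureReal_le_sum_le_exp {Z : Fin n → Ω → ℝ} (hind : iIndepFun Z P)
    (hZ : ∀ j, AEMeasurable (Z j) P) {s K : ℝ} (hs : 0 ≤ s)
    (hint : ∀ j, Integrable (fun ω => Real.exp (s * Z j ω)) P)
    (hmgf : ∀ j, mgf (Z j) P s ≤ Real.exp K) (x : ℝ) :
    P.real {ω | n * x ≤ ∑ j, Z j ω} ≤ Real.exp (n * (K - s * x)) := by
  have h1 : Integrable (fun ω => Real.exp (s * (∑ j, Z j) ω)) P := by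
    have hcongr : ∀ j, Z j =ᵐ[P] (hZ j).mk (Z j) := fun j => (hZ j).ae_eq_mk
    have h0 := (hind.congr hcongr).integrable_exp_mul_sum (t := s) (s := Finset.univ)
      (fun j => (hZ j).measurable_mk) (fun j _ => (hint j).congr (by
        filter_upwards [hcongr j] with ω hω
        rw [hω]))
    refine h0.congr ?_
    filter_upwards [ae_all_iff.2 hcongr] with ω hω
    simp only [Finset.sum_apply, hω]
  have h2 := measure_ge_le_exp_mul_mgf (n * x) hs h1
  rw [hind.mgf_sum₀ hZ] at h2
  simp only [Finset.sum_apply] at h2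
  refine h2.trans ?_
  calc Real.exp (-s * (n * x)) * ∏ j, mgf (Z j) P s
      ≤ Real.exp (-s * (n * x)) * ∏ _j : Fin n, Real.exp K := by
        gcongr
        · exact fun j _ => mgf_nonneg
        · exact hmgf _
    _ = Real.exp (n * (K - s * x)) := by
        rw [Finset.prod_const, Finset.card_univ, Fintype.card_fin, ← Real.exp_nat_mul,
          ← Real.exp_add]
        congr 1; ring

theorem measureReal_le_abs_average_le_exp (hn : 1 ≤ n) {Z : Fin n → Ω → ℝ}
    (hind : iIndepFun Z P) (hZ : ∀ j, AEMeasurable (Z j) P) {s K : ℝ} (hs : 0 ≤ s)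
    (hint : ∀ j, ∀ r : ℝ, |r| ≤ s → Integrable (fun ω => Real.exp (r * Z j ω)) P)
    (hmgf : ∀ j, ∀ r : ℝ, |r| = s → mgf (Z j) P r ≤ Real.exp K) (x : ℝ) :
    P.real {ω | x ≤ |(n : ℝ)⁻¹ * ∑ j, Z j ω|} ≤ 2 * Real.exp (n * (K - s * x)) := by
  have hn' : (0 : ℝ) < n := by exact_mod_cast hn
  have h1 := measureReal_le_sum_le_exp hind hZ hs (fun j => hint j s (abs_of_nonneg hs).le)
    (fun j => hmgf j s (abs_of_nonneg hs)) x
  have hneg : iIndepFun (fun j ω => -Z j ω) P :=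
    hind.comp (fun _ y => -y) (fun _ => measurable_neg)
  have h2 := measureReal_le_sum_le_exp hneg (fun j => (hZ j).neg) hs (K := K)
    (fun j => by simpa using hint j (-s) (by simp [abs_of_nonneg hs]))
    (fun j => by
      have := hmgf j (-s) (by simp [abs_of_nonneg hs])
      simpa [mgf] using this) x
  have hsub : {ω | x ≤ |(n : ℝ)⁻¹ * ∑ j, Z j ω|} ⊆
      {ω | n * x ≤ ∑ j, Z j ω} ∪ {ω | n * x ≤ ∑ j, -Z j ω} := by
    intro ω hω
    simp only [Set.mem_ofPred_eq, Set.mem_union, Finset.sum_neg_distrib] at hω ⊢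
    rw [← div_eq_inv_mul, abs_div, abs_of_pos hn', le_div_iff₀ hn', mul_comm] at hω
    exact le_abs.1 hω
  calc _ ≤ _ := measureReal_mono hsub
    _ ≤ _ := measureReal_union_le _ _
    _ ≤ _ := by linarith

/-- Concentration of the empirical second moment of a centered normal function. The scale `V` is
only an upper bound for the variance `v`, so that `v = 0` needs no separate treatment. -/
theorem measureReal_abs_average_sq_sub_le (hn : 1 ≤ n) {X : Fin n → Ω → S}
    (hXlaw : ∀ j, HasLaw (X j) Pi P) (hXind : iIndepFun X P) {f : S → ℝ} (hf : Measurable f)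
    {v : NNReal} (hflaw : HasLaw f (gaussianReal 0 v) Pi) {V t : ℝ} (hV : 0 < V)
    (hvV : (v : ℝ) ≤ V) (ht : 0 < t) (ht1 : t ≤ 1) :
    P.real {ω | t * V ≤ |(n : ℝ)⁻¹ * ∑ j, (f (X j ω) ^ 2 - v)|} ≤
      2 * Real.exp (-(n * t ^ 2 / 16)) := by
  have hlaw : ∀ j, HasLaw (fun ω => f (X j ω)) (gaussianReal 0 v) P := fun j =>
    hflaw.comp (hXlaw j)
  have hind : iIndepFun (fun j ω => f (X j ω) ^ 2 - v) P :=
    hXind.comp (fun _ y => f y ^ 2 - v) (fun _ => by fun_prop)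
  have hae : ∀ j, AEMeasurable (fun ω => f (X j ω) ^ 2 - v) P := fun j => by
    have := (hlaw j).aemeasurable
    fun_prop
  have hv0 : (0 : ℝ) ≤ v := v.2
  have hsmall : ∀ r : ℝ, |r| ≤ t / (8 * V) → |2 * r * v| ≤ t / 4 := by
    intro r hr
    rw [le_div_iff₀ (by positivity)] at hr
    rw [abs_mul, abs_mul, abs_two, abs_of_nonneg hv0]
    nlinarith [abs_nonneg r]
  have hmom : ∀ j, ∀ r : ℝ, |r| ≤ t / (8 * V) →
      Integrable (fun ω => Real.exp (r * (f (X j ω) ^ 2 - v))) P ∧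
        ∫ ω, Real.exp (r * (f (X j ω) ^ 2 - v)) ∂P ≤ Real.exp (t ^ 2 / 16) := by
    intro j r hr
    have h1 := hsmall r hr
    have h2 := integral_exp_mul_sq_gaussianReal v (s := r) (by linarith)
    have h3 : ∀ ω, Real.exp (r * (f (X j ω) ^ 2 - v)) =
        Real.exp (-(r * v)) * Real.exp (r * f (X j ω) ^ 2) := by
      intro ω
      rw [← Real.exp_add]; congr 1; ring
    simp only [h3]
    have h4 : ∫ ω, Real.exp (r * f (X j ω) ^ 2) ∂P = (√(1 - 2 * r * v))⁻¹ := by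
      rw [← h2.2]
      exact (hlaw j).integral_comp (f := fun y : ℝ => Real.exp (r * y ^ 2)) (by fun_prop)
    have h5 : Integrable (fun ω => Real.exp (r * f (X j ω) ^ 2)) P := by
      have := h2.1
      rw [← (hlaw j).map_eq] at this
      exact this.comp_aemeasurable (hlaw j).aemeasurable
    refine ⟨h5.const_mul _, ?_⟩
    rw [integral_const_mul, h4]
    calc Real.exp (-(r * v)) * (√(1 - 2 * r * v))⁻¹
        ≤ Real.exp (-(r * v)) * Real.exp (2 * r * v / 2 + (2 * r * v) ^ 2) := by
          gcongr
          exact inv_sqrt_one_sub_le (by linarith)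
      _ = Real.exp ((2 * r * v) ^ 2) := by rw [← Real.exp_add]; congr 1; ring
      _ ≤ Real.exp (t ^ 2 / 16) := by
          refine Real.exp_le_exp.2 ?_
          rw [← sq_abs]
          nlinarith [abs_nonneg (2 * r * v)]
  have := measureReal_le_abs_average_le_exp hn hind hae (s := t / (8 * V)) (K := t ^ 2 / 16)
    (by positivity) (fun j r hr => (hmom j r hr).1) (fun j r hr => (hmom j r hr.le).2) (t * V)
  refine this.trans (le_of_eq ?_)
  congr 2
  field_simp
  ring

/-- The pairs formed by an i.i.d. design and an independent i.i.d. noise are i.i.d. -/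
theorem iIndepFun_prodMk {R : Type*} [MeasurableSpace R] {ν : Measure R} [IsProbabilityMeasure ν]
    [IsProbabilityMeasure Pi] {X : Fin n → Ω → S} {ξ : Fin n → Ω → R}
    (hXlaw : ∀ j, HasLaw (X j) Pi P) (hXind : iIndepFun X P)
    (hξlaw : ∀ j, HasLaw (ξ j) ν P) (hξind : iIndepFun ξ P)
    (hXξ : IndepFun (fun ω j => X j ω) (fun ω j => ξ j ω) P) :
    (∀ j, HasLaw (fun ω => (X j ω, ξ j ω)) (Pi.prod ν) P) ∧
      iIndepFun (fun j ω => (X j ω, ξ j ω)) P := by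
  have hpair : ∀ j, HasLaw (fun ω => (X j ω, ξ j ω)) (Pi.prod ν) P := by
    intro j
    have : IndepFun (X j) (ξ j) P :=
      IndepFun.comp (φ := fun x : Fin n → S => x j) (ψ := fun x : Fin n → R => x j) hXξ
        (measurable_pi_apply j) (measurable_pi_apply j)
    exact this.hasLaw_prod (hXlaw j) (hξlaw j)
  refine ⟨hpair, ?_⟩
  rw [iIndepFun_iff_hasLaw_pi_pi hpair]
  have h1 := hXξ.hasLaw_prod (hXind.hasLaw_pi hXlaw) (hξind.hasLaw_pi hξlaw)
  have h2 := (measurePreserving_arrowProdEquivProdArrow S R (Fin n) (fun _ => Pi)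
    (fun _ => ν)).symm
  exact h2.fun_comp_hasLaw h1

/-- Tail bound for the correlation of a normal function of the design with the noise. -/
theorem measureReal_abs_average_mul_noise_le (hn : 1 ≤ n) [IsProbabilityMeasure Pi]
    {X : Fin n → Ω → S} (hXlaw : ∀ j, HasLaw (X j) Pi P) (hXind : iIndepFun X P)
    {w : NNReal} {ξ : Fin n → Ω → ℝ} (hξlaw : ∀ j, HasLaw (ξ j) (gaussianReal 0 w) P)
    (hξind : iIndepFun ξ P) (hXξ : IndepFun (fun ω j => X j ω) (fun ω j => ξ j ω) P)
    {f : S → ℝ} (hf : Measurable f) {v : NNReal} (hflaw : HasLaw f (gaussianReal 0 v) Pi)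
    {s T : ℝ} (hs : 0 ≤ s) (hT : (w : ℝ) * v ≤ T) (hsT : s ^ 2 * T ≤ 1 / 2) (x : ℝ) :
    P.real {ω | x ≤ |(n : ℝ)⁻¹ * ∑ j, f (X j ω) * ξ j ω|} ≤
      2 * Real.exp (n * (s ^ 2 * T - s * x)) := by
  obtain ⟨-, hind0⟩ := iIndepFun_prodMk hXlaw hXind hξlaw hξind hXξ
  have hind : iIndepFun (fun j ω => f (X j ω) * ξ j ω) P :=
    hind0.comp (fun _ p => f p.1 * p.2) (fun _ => by fun_prop)
  have hlaw : ∀ j, HasLaw (fun ω => (f (X j ω), ξ j ω))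
      ((gaussianReal 0 v).prod (gaussianReal 0 w)) P := by
    intro j
    have : IndepFun (fun ω => f (X j ω)) (ξ j) P :=
      IndepFun.comp (φ := fun x : Fin n → S => f (x j)) (ψ := fun x : Fin n → ℝ => x j) hXξ
        (by fun_prop) (by fun_prop)
    exact this.hasLaw_prod (hflaw.comp (hXlaw j)) (hξlaw j)
  have hae : ∀ j, AEMeasurable (fun ω => f (X j ω) * ξ j ω) P := fun j => by
    exact ((hlaw j).aemeasurable.fst).mul (hlaw j).aemeasurable.snd
  have hmom : ∀ j, ∀ r : ℝ, |r| ≤ s →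
      Integrable (fun ω => Real.exp (r * (f (X j ω) * ξ j ω))) P ∧
        ∫ ω, Real.exp (r * (f (X j ω) * ξ j ω)) ∂P ≤ Real.exp (s ^ 2 * T) := by
    intro j r hr
    have hr2 : r ^ 2 ≤ s ^ 2 := sq_le_sq' (abs_le.1 hr).1 (abs_le.1 hr).2
    have hwv : (0 : ℝ) ≤ w * v := by positivity
    have h0 : r ^ 2 * w * v ≤ s ^ 2 * T := by
      calc r ^ 2 * w * v = r ^ 2 * (w * v) := by ring
        _ ≤ s ^ 2 * T := by gcongr
    have h2 := integral_exp_mul_mul_gaussianReal_prod v w (s := r) (h0.trans hsT)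
    constructor
    · have := h2.1
      rw [← (hlaw j).map_eq] at this
      exact this.comp_aemeasurable (hlaw j).aemeasurable
    · have h3 := (hlaw j).integral_comp (f := fun p : ℝ × ℝ => Real.exp (r * (p.1 * p.2)))
        (by fun_prop)
      refine (le_of_eq h3).trans (h2.2.trans (Real.exp_le_exp.2 h0))
  exact measureReal_le_abs_average_le_exp hn hind hae hs (fun j r hr => (hmom j r hr).1)
    (fun j r hr => (hmom j r hr.le).2) x

end Chernoff

/-! ### Nets and quadratic forms on sparse vectors -/

section Net

variable {E : Type*} [NormedAddCommGroup E] [NormedSpace ℝ E] [FiniteDimensional ℝ E]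

variable (E) in
theorem exists_net : ∃ T : Finset E, T.card ≤ 5 ^ Module.finrank ℝ E ∧ (∀ c ∈ T, ‖c‖ ≤ 2) ∧
    ∀ x : E, ‖x‖ ≤ 2 → ∃ c ∈ T, ‖x - c‖ ≤ 1 := by
  classical
  -- a set of separated points of maximal cardinality is a net
  let p : ℕ → Prop := fun k => ∃ T : Finset E, T.card = k ∧ (∀ c ∈ T, ‖c‖ ≤ 2) ∧
    ∀ c ∈ T, ∀ d ∈ T, c ≠ d → 1 ≤ ‖c - d‖
  have hbound : ∀ T : Finset E, (∀ c ∈ T, ‖c‖ ≤ 2) →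
      (∀ c ∈ T, ∀ d ∈ T, c ≠ d → 1 ≤ ‖c - d‖) → T.card ≤ 5 ^ Module.finrank ℝ E :=
    fun T h1 h2 => Besicovitch.card_le_of_separated T h1 h2
  have hp : p (Nat.findGreatest p (5 ^ Module.finrank ℝ E)) :=
    Nat.findGreatest_spec (m := 0) (Nat.zero_le _) ⟨∅, by simp⟩
  obtain ⟨T, hcard, hT2, hTsep⟩ := hp
  refine ⟨T, hbound T hT2 hTsep, hT2, fun x hx => ?_⟩
  by_contra! hfar
  have hxT : x ∉ T := fun h => by
    have := hfar x h
    simp at this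
    linarith
  have h2 : ∀ c ∈ insert x T, ‖c‖ ≤ 2 := by
    intro c hc
    rcases Finset.mem_insert.1 hc with rfl | hc
    exacts [hx, hT2 c hc]
  have hsep : ∀ c ∈ insert x T, ∀ d ∈ insert x T, c ≠ d → 1 ≤ ‖c - d‖ := by
    intro c hc d hd hne
    rcases Finset.mem_insert.1 hc with hcx | hcT <;> rcases Finset.mem_insert.1 hd with hdx | hdT
    · exact absurd (hcx.trans hdx.symm) hne
    · rw [hcx]; exact (hfar d hdT).le
    · rw [hdx, norm_sub_rev]; exact (hfar c hcT).le
    · exact hTsep c hcT d hdT hne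
  have := Nat.le_findGreatest (hbound _ h2 hsep) (show p (insert x T).card from ⟨_, rfl, h2, hsep⟩)
  rw [Finset.card_insert_of_notMem hxT] at this
  omega

theorem abs_le_mul_norm_of_net {T : Finset E}
    (hT : ∀ x : E, ‖x‖ ≤ 2 → ∃ c ∈ T, ‖x - c‖ ≤ 1) (l : E →ₗ[ℝ] ℝ) {b : ℝ} (hb : 0 ≤ b)
    (hl : ∀ c ∈ T, |l c| ≤ b) (x : E) : |l x| ≤ b * ‖x‖ := by
  set L : E →L[ℝ] ℝ := LinearMap.toContinuousLinearMap l with hL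
  have hLx : ∀ x, L x = l x := fun x => rfl
  have h1 : ∀ x : E, ‖x‖ ≤ 2 → |l x| ≤ b + ‖L‖ := by
    intro x hx
    obtain ⟨c, hc, hxc⟩ := hT x hx
    have h2 : |l (x - c)| ≤ ‖L‖ := by
      have := L.le_opNorm (x - c)
      rw [hLx, Real.norm_eq_abs] at this
      nlinarith [norm_nonneg L]
    have h3 : l x = l c + l (x - c) := by rw [map_sub]; ring
    rw [h3]
    exact (abs_add_le _ _).trans (add_le_add (hl c hc) h2)
  have h2 : ‖L‖ ≤ (b + ‖L‖) / 2 := by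
    refine L.opNorm_le_bound' (by positivity) fun x hx => ?_
    have hx0 : 0 < ‖x‖ := lt_of_le_of_ne (norm_nonneg x) (Ne.symm hx)
    have h3 := h1 ((2 / ‖x‖) • x) (by
      rw [norm_smul, Real.norm_eq_abs, abs_of_pos (by positivity), div_mul_cancel₀ _ hx])
    rw [map_smul, smul_eq_mul, abs_mul, abs_of_pos (by positivity), div_mul_eq_mul_div,
      div_le_iff₀ hx0] at h3
    rw [hLx, Real.norm_eq_abs]
    linarith
  have h4 := L.le_opNorm x
  rw [hLx, Real.norm_eq_abs] at h4
  nlinarith [norm_nonneg x]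

/-- A symmetric bilinear form is controlled by its diagonal values at the sums and differences of
the points of a net. Passing through the bilinear form makes a net of radius as large as half the
radius of the ball sufficient. -/
theorem abs_apply_self_le_of_net {T : Finset E}
    (hT : ∀ x : E, ‖x‖ ≤ 2 → ∃ c ∈ T, ‖x - c‖ ≤ 1) (M : LinearMap.BilinForm ℝ E)
    (hM : ∀ x y, M x y = M y x) {b : ℝ} (hb : 0 ≤ b)
    (hadd : ∀ c ∈ T, ∀ d ∈ T, |M (c + d) (c + d)| ≤ b)
    (hsub : ∀ c ∈ T, ∀ d ∈ T, |M (c - d) (c - d)| ≤ b) (x : E) :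
    |M x x| ≤ b / 2 * ‖x‖ ^ 2 := by
  have h1 : ∀ c ∈ T, ∀ d ∈ T, |M c d| ≤ b / 2 := by
    intro c hc d hd
    have h2 : M c d = (M (c + d) (c + d) - M (c - d) (c - d)) / 4 := by
      simp only [map_add, map_sub, LinearMap.add_apply, LinearMap.sub_apply, hM d c]
      ring
    have h3 := abs_le.1 (hadd c hc d hd)
    have h4 := abs_le.1 (hsub c hc d hd)
    rw [h2, abs_le]
    constructor <;> linarith [h3.1, h3.2, h4.1, h4.2]
  have h2 : ∀ c ∈ T, |M c x| ≤ b / 2 * ‖x‖ := fun c hc =>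
    abs_le_mul_norm_of_net hT (M c) (by positivity) (h1 c hc) x
  have h3 := abs_le_mul_norm_of_net hT (M x) (b := b / 2 * ‖x‖) (by positivity)
    (fun c hc => by rw [hM]; exact h2 c hc) x
  linarith

end Net

variable {N : ℕ}

/-- The coordinate subspace of the vectors that vanish outside `J`. -/
def coordSubspace (J : Finset (Fin N)) : Submodule ℝ (EuclideanSpace ℝ (Fin N)) where
  carrier := {x | ∀ i ∉ J, x i = 0}
  add_mem' := fun hx hy i hi => by simp [hx i hi, hy i hi]
  zero_mem' := fun i _ => rfl
  smul_mem' := fun c x hx i hi => by simp [hx i hi]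

theorem sparsity_le_of_mem_coordSubspace {J : Finset (Fin N)} {x : EuclideanSpace ℝ (Fin N)}
    (hx : x ∈ coordSubspace J) : sparsity x ≤ J.card := by
  refine Finset.card_le_card fun i hi => ?_
  by_contra h
  exact (Finset.mem_filter.1 hi).2 (hx i h)

theorem finrank_coordSubspace_le (J : Finset (Fin N)) :
    Module.finrank ℝ (coordSubspace J) ≤ J.card := by
  let f : coordSubspace J →ₗ[ℝ] (J → ℝ) :=
    { toFun := fun x i => x.1 i
      map_add' := fun x y => rfl
      map_smul' := fun c x => rfl }
  have hf : Function.Injective f := by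
    intro x y hxy
    ext i
    by_cases hi : i ∈ J
    · exact congrFun hxy ⟨i, hi⟩
    · rw [x.2 i hi, y.2 i hi]
  simpa using LinearMap.finrank_le_finrank_of_injective hf

/-- The number of supports of size at most `m` is at most `q ^ (-m) * (1 + q) ^ N` for every
`q ∈ (0, 1]`. -/
theorem card_filter_card_le {q : ℝ} (hq : 0 < q) (hq1 : q ≤ 1) (m : ℕ) :
    ((Finset.univ.filter fun J : Finset (Fin N) => J.card ≤ m).card : ℝ) ≤
      (q⁻¹) ^ m * (1 + q) ^ N := by
  have h1 : ∑ J : Finset (Fin N), q ^ J.card = (1 + q) ^ N := by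
    have := Fin.sum_pow_mul_eq_add_pow (n := N) q (1 : ℝ)
    simpa [add_comm] using this
  have h2 : ((Finset.univ.filter fun J : Finset (Fin N) => J.card ≤ m).card : ℝ) * q ^ m ≤
      (1 + q) ^ N := by
    rw [← h1, ← nsmul_eq_mul]
    calc _ ≤ ∑ J ∈ Finset.univ.filter (fun J : Finset (Fin N) => J.card ≤ m), q ^ J.card := by
          refine Finset.card_nsmul_le_sum _ _ _ fun J hJ => ?_
          exact pow_le_pow_of_le_one hq.le hq1 (Finset.mem_filter.1 hJ).2
      _ ≤ _ := Finset.sum_le_sum_of_subset_of_nonneg (Finset.filter_subset _ _)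
          fun _ _ _ => by positivity
  rw [inv_pow, ← div_eq_inv_mul, le_div_iff₀ (by positivity)]
  exact h2

/-- A finite set of sparse vectors which controls all quadratic forms on the sparse vectors. -/
theorem exists_sparse_net (N m : ℕ) : ∃ G : Finset (EuclideanSpace ℝ (Fin N)),
    G.card ≤ (Finset.univ.filter fun J : Finset (Fin N) => J.card ≤ m).card * (2 * 25 ^ m) ∧
    (∀ w ∈ G, sparsity w ≤ m ∧ ‖w‖ ≤ 4) ∧
    ∀ M : LinearMap.BilinForm ℝ (EuclideanSpace ℝ (Fin N)), (∀ x y, M x y = M y x) →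
      ∀ b : ℝ, 0 ≤ b → (∀ w ∈ G, |M w w| ≤ b) →
        ∀ x, sparsity x ≤ m → |M x x| ≤ b / 2 * ‖x‖ ^ 2 := by
  classical
  choose T hTcard hT2 hTnet using fun J : Finset (Fin N) => exists_net (coordSubspace J)
  let GJ : Finset (Fin N) → Finset (EuclideanSpace ℝ (Fin N)) := fun J =>
    (T J ×ˢ T J).image (fun p => ((p.1 + p.2 : coordSubspace J) : EuclideanSpace ℝ (Fin N))) ∪
      (T J ×ˢ T J).image (fun p => ((p.1 - p.2 : coordSubspace J) : EuclideanSpace ℝ (Fin N)))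
  refine ⟨(Finset.univ.filter fun J : Finset (Fin N) => J.card ≤ m).biUnion GJ, ?_, ?_, ?_⟩
  · refine Finset.card_biUnion_le_card_mul _ _ _ fun J hJ => ?_
    have hJ' := (Finset.mem_filter.1 hJ).2
    have h1 : (T J ×ˢ T J).card ≤ 25 ^ m := by
      rw [Finset.card_product]
      have h5 : (T J).card ≤ 5 ^ m := (hTcard J).trans
        (Nat.pow_le_pow_right (by norm_num) ((finrank_coordSubspace_le J).trans hJ'))
      calc _ ≤ 5 ^ m * 5 ^ m := Nat.mul_le_mul h5 h5
        _ = 25 ^ m := by rw [← mul_pow]; norm_num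
    calc (GJ J).card ≤ _ := Finset.card_union_le _ _
      _ ≤ (T J ×ˢ T J).card + (T J ×ˢ T J).card :=
          Nat.add_le_add Finset.card_image_le Finset.card_image_le
      _ ≤ _ := by omega
  · intro w hw
    obtain ⟨J, hJ, hw⟩ := Finset.mem_biUnion.1 hw
    have hJ' := (Finset.mem_filter.1 hJ).2
    rcases Finset.mem_union.1 hw with hw | hw <;>
      obtain ⟨p, hp, rfl⟩ := Finset.mem_image.1 hw <;>
      refine ⟨(sparsity_le_of_mem_coordSubspace (Subtype.property _)).trans hJ', ?_⟩ <;>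
      have h1 := hT2 J _ (Finset.mem_product.1 hp).1 <;>
      have h2 := hT2 J _ (Finset.mem_product.1 hp).2
    · exact (norm_add_le p.1 p.2).trans (by linarith)
    · exact (norm_sub_le p.1 p.2).trans (by linarith)
  · intro M hM b hb hG x hx
    let J : Finset (Fin N) := Finset.univ.filter fun j => x j ≠ 0
    have hxJ : x ∈ coordSubspace J := fun i hi => by simpa [J] using hi
    have hJm : J ∈ Finset.univ.filter fun J : Finset (Fin N) => J.card ≤ m :=
      Finset.mem_filter.2 ⟨Finset.mem_univ _, hx⟩
    let M' : LinearMap.BilinForm ℝ (coordSubspace J) :=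
      M.compl₁₂ (coordSubspace J).subtype (coordSubspace J).subtype
    have h := abs_apply_self_le_of_net (hTnet J) M' (fun _ _ => hM _ _) hb
      (fun c hc d hd => hG _ (Finset.mem_biUnion.2 ⟨J, hJm, Finset.mem_union_left _
        (Finset.mem_image.2 ⟨(c, d), Finset.mem_product.2 ⟨hc, hd⟩, rfl⟩)⟩))
      (fun c hc d hd => hG _ (Finset.mem_biUnion.2 ⟨J, hJm, Finset.mem_union_right _
        (Finset.mem_image.2 ⟨(c, d), Finset.mem_product.2 ⟨hc, hd⟩, rfl⟩)⟩)) ⟨x, hxJ⟩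
    simpa [M'] using h

/-! ### From sparse vectors to the cone of dominant coordinates -/

section Deterministic

variable {N : ℕ}

theorem sparsity_add_single_le (v : EuclideanSpace ℝ (Fin N)) (i : Fin N) (c : ℝ) :
    sparsity (v + EuclideanSpace.single i c) ≤ sparsity v + 1 := by
  classical
  have h : (Finset.univ.filter fun j => (v + EuclideanSpace.single i c) j ≠ 0) ⊆
      insert i (Finset.univ.filter fun j => v j ≠ 0) := by
    intro j hj
    by_cases hji : j = i
    · simp [hji]
    · simpa [hji] using hj
  exact (Finset.card_le_card h).trans (Finset.card_insert_le _ _)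

theorem sparsity_zero : sparsity (0 : EuclideanSpace ℝ (Fin N)) = 0 := by
  simp [sparsity]

theorem eq_zero_of_l1Norm_eq_zero {u : EuclideanSpace ℝ (Fin N)} (hu : l1Norm u = 0) : u = 0 := by
  ext i
  simpa using (Finset.sum_eq_zero_iff_of_nonneg fun i _ => abs_nonneg (u i)).1 hu i
    (Finset.mem_univ i)

/-- Maurey's empirical method: if a quadratic form is nonnegative on `m`-sparse vectors, then the
mean of its values at the sum of `v` and `k` independent random multiples of coordinate vectors is
nonnegative as long as `v` is `(m - k)`-sparse. The mean is written out, and the induction on `k`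
averages over one more summand. -/
theorem nonneg_mean_of_nonneg_sparse (W : LinearMap.BilinForm ℝ (EuclideanSpace ℝ (Fin N)))
    (hsymm : ∀ x y, W x y = W y x) {m : ℕ} (hW : ∀ v, sparsity v ≤ m → 0 ≤ W v v)
    (p : Fin N → ℝ) (hp : ∀ i, 0 ≤ p i) (hp1 : ∑ i, p i = 1) (c : Fin N → ℝ)
    (u : EuclideanSpace ℝ (Fin N)) (hu : u = ∑ i, p i • EuclideanSpace.single i (c i))
    (k : ℕ) : ∀ v, sparsity v + k ≤ m →
      0 ≤ W v v + 2 * k * W v u +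
        k * ∑ i, p i * W (EuclideanSpace.single i (c i)) (EuclideanSpace.single i (c i)) +
        k * (k - 1) * W u u := by
  induction k with
  | zero => intro v hv; simpa using hW v (by omega)
  | succ k ih =>
    intro v hv
    set e : Fin N → EuclideanSpace ℝ (Fin N) := fun i => EuclideanSpace.single i (c i) with he
    set s : ℝ := ∑ i, p i * W (e i) (e i) with hs
    have hWu : ∀ x, ∑ i, p i * W x (e i) = W x u := by
      intro x
      rw [hu, map_sum]
      simp [he]
    have h1 : ∀ i, 0 ≤ W (v + e i) (v + e i) + 2 * k * W (v + e i) u + k * s +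
        k * (k - 1) * W u u := fun i =>
      ih (v + e i) (by have := sparsity_add_single_le v i (c i); simp only [he]; omega)
    have h2 : 0 ≤ ∑ i, p i * (W (v + e i) (v + e i) + 2 * k * W (v + e i) u + k * s +
        k * (k - 1) * W u u) := Finset.sum_nonneg fun i _ => mul_nonneg (hp i) (h1 i)
    have h3 : ∑ i, p i * (W (v + e i) (v + e i) + 2 * k * W (v + e i) u + k * s +
        k * (k - 1) * W u u) =
        (∑ i, p i) * (W v v + 2 * k * W v u + k * s + k * (k - 1) * W u u) +
          2 * ∑ i, p i * W v (e i) + ∑ i, p i * W (e i) (e i) +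
          2 * k * ∑ i, p i * W u (e i) := by
      simp only [Finset.sum_mul, Finset.mul_sum, ← Finset.sum_add_distrib]
      refine Finset.sum_congr rfl fun i _ => ?_
      simp only [map_add, LinearMap.add_apply, hsymm (e i) v, hsymm (e i) u]
      ring
    rw [h3, hp1, hWu, hWu, ← hs] at h2
    push_cast
    linarith

/-- A quadratic form that is nonnegative on `m`-sparse vectors is almost nonnegative on vectors
whose `ℓ₁`-norm is small. -/
theorem nonneg_add_of_nonneg_sparse (W : LinearMap.BilinForm ℝ (EuclideanSpace ℝ (Fin N)))
    (hsymm : ∀ x y, W x y = W y x) {m : ℕ} (hm : 1 ≤ m)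
    (hW : ∀ v, sparsity v ≤ m → 0 ≤ W v v) {K : ℝ}
    (hK : ∀ i, W (EuclideanSpace.single i 1) (EuclideanSpace.single i 1) ≤ K)
    (u : EuclideanSpace ℝ (Fin N)) : 0 ≤ (m - 1) * W u u + K * l1Norm u ^ 2 := by
  have hm' : (1 : ℝ) ≤ m := by exact_mod_cast hm
  have hl0 : 0 ≤ l1Norm u := Finset.sum_nonneg fun _ _ => abs_nonneg _
  rcases hl0.eq_or_lt with hl | hl
  · simp [eq_zero_of_l1Norm_eq_zero hl.symm, l1Norm]
  set l := l1Norm u with hldef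
  -- the coordinate `i` is drawn with probability proportional to `|u i|`
  have hmean := nonneg_mean_of_nonneg_sparse W hsymm hW (fun i => |u i| / l)
    (fun i => by positivity) (by rw [← Finset.sum_div, ← l1Norm, ← hldef, div_self hl.ne'])
    (fun i => SignType.sign (u i) * l) u (by
      ext j
      simp only [WithLp.ofLp_sum, WithLp.ofLp_smul, Finset.sum_apply,
        Pi.smul_apply, smul_eq_mul, PiLp.ofLp_single, Pi.single_apply, mul_ite, mul_zero,
        Finset.sum_ite_eq, Finset.mem_univ, if_true]
      rw [div_mul_eq_mul_div, eq_div_iff hl.ne', ← mul_assoc, mul_comm |u j|, sign_mul_abs])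
    m 0 (by simp [sparsity_zero])
  have hdiag : ∑ i, |u i| / l * W (EuclideanSpace.single i (SignType.sign (u i) * l))
      (EuclideanSpace.single i (SignType.sign (u i) * l)) ≤ K * l ^ 2 := by
    have h1 : ∀ i, |u i| / l * W (EuclideanSpace.single i (SignType.sign (u i) * l))
        (EuclideanSpace.single i (SignType.sign (u i) * l)) ≤ |u i| * (K * l) := by
      intro i
      have h2 : ∀ a : ℝ, EuclideanSpace.single i a = a • EuclideanSpace.single i (1 : ℝ) := by
        intro a
        ext j
        simp
      rw [h2]
      simp only [map_smul, LinearMap.smul_apply, smul_eq_mul]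
      rcases eq_or_ne (u i) 0 with h0 | h0
      · simp [h0]
      have h3 : ((SignType.sign (u i) : ℝ)) * (SignType.sign (u i) : ℝ) = 1 := by
        rcases lt_or_gt_of_ne h0 with h | h <;> simp [h]
      calc _ = |u i| * ((SignType.sign (u i) : ℝ) * (SignType.sign (u i) : ℝ)) * l *
            W (EuclideanSpace.single i 1) (EuclideanSpace.single i 1) := by
            field_simp
        _ ≤ |u i| * 1 * l * K := by
            rw [h3]
            exact mul_le_mul_of_nonneg_left (hK i) (by positivity)
        _ = _ := by ring
    calc _ ≤ ∑ i, |u i| * (K * l) := Finset.sum_le_sum fun i _ => h1 i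
      _ = K * l ^ 2 := by rw [← Finset.sum_mul, ← l1Norm, ← hldef]; ring
  simp only [map_zero, LinearMap.zero_apply, mul_zero, zero_add] at hmean
  have h4 : (m : ℝ) * 0 ≤ m * ((m - 1) * W u u + K * l ^ 2) := by
    nlinarith
  exact le_of_mul_le_mul_left h4 (by linarith)

/-- If `lam` has at most the `ℓ₁`-norm of `mu`, then `lam - mu` is concentrated on the support of
`mu`. -/
theorem l1Norm_sub_le (lam mu : EuclideanSpace ℝ (Fin N)) (h : l1Norm lam ≤ l1Norm mu) :
    l1Norm (lam - mu) ≤ 2 * √(sparsity mu : ℝ) * ‖lam - mu‖ := by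
  set J : Finset (Fin N) := Finset.univ.filter fun j => mu j ≠ 0 with hJ
  set u := lam - mu with hu
  have h1 : ∀ j, |u j| ≤ (|lam j| - |mu j|) + 2 * (if mu j ≠ 0 then |u j| else 0) := by
    intro j
    have hj : u j = lam j - mu j := rfl
    split_ifs with h0
    · have := abs_sub_abs_le_abs_sub (mu j) (lam j)
      rw [abs_sub_comm, ← hj] at this
      linarith
    · push Not at h0
      simp [hj, h0]
  have h2 : l1Norm u ≤ 2 * ∑ j ∈ J, |u j| := by
    calc l1Norm u ≤ ∑ j, ((|lam j| - |mu j|) + 2 * (if mu j ≠ 0 then |u j| else 0)) :=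
          Finset.sum_le_sum fun j _ => h1 j
      _ = (l1Norm lam - l1Norm mu) + 2 * ∑ j ∈ J, |u j| := by
          rw [Finset.sum_add_distrib, Finset.sum_sub_distrib, ← Finset.mul_sum, hJ,
            Finset.sum_filter]
          rfl
      _ ≤ _ := by linarith
  have h3 : (∑ j ∈ J, |u j|) ^ 2 ≤ (sparsity mu : ℝ) * ‖u‖ ^ 2 := by
    calc (∑ j ∈ J, |u j|) ^ 2 ≤ J.card * ∑ j ∈ J, |u j| ^ 2 := sq_sum_le_card_mul_sum_sq
      _ ≤ J.card * ∑ j, |u j| ^ 2 := by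
          gcongr
          exact Finset.subset_univ J
      _ = _ := by
          rw [EuclideanSpace.norm_sq_eq]
          simp [sparsity, hJ]
  have h4 : ∑ j ∈ J, |u j| ≤ √(sparsity mu : ℝ) * ‖u‖ := by
    refine abs_le_of_sq_le_sq' ?_ (by positivity) |>.2
    rw [mul_pow, Real.sq_sqrt (by positivity)]
    exact h3
  linarith

/-- A restricted isometry on `3 d`-sparse vectors bounds the `ℓ₂`-error of a vector `lam` which has
at most the `ℓ₁`-norm of a `d`-sparse vector `mu` and almost the same correlations with the
dictionary. -/
theorem norm_sub_le_of_restricted_isometry (B : LinearMap.BilinForm ℝ (EuclideanSpace ℝ (Fin N)))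
    (hsymm : ∀ x y, B x y = B y x) {d : ℕ} (hd : 1 ≤ d)
    (hB : ∀ x, sparsity x ≤ 3 * d → |B x x - ‖x‖ ^ 2| ≤ 1 / 16 * ‖x‖ ^ 2)
    (lam mu : EuclideanSpace ℝ (Fin N)) (hmu : sparsity mu ≤ d) (h : l1Norm lam ≤ l1Norm mu)
    {ε : ℝ} (hε : 0 ≤ ε) (hcorr : ∀ k, |B (lam - mu) (EuclideanSpace.single k 1)| ≤ 2 * ε) :
    ‖lam - mu‖ ≤ 8 * √(sparsity mu : ℝ) * ε := by
  set u := lam - mu with hu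
  set s : ℝ := √(sparsity mu : ℝ) with hs
  have hs0 : 0 ≤ s := Real.sqrt_nonneg _
  have hs2 : s ^ 2 = sparsity mu := Real.sq_sqrt (by positivity)
  have hcone : l1Norm u ≤ 2 * s * ‖u‖ := l1Norm_sub_le lam mu h
  have hl0 : 0 ≤ l1Norm u := Finset.sum_nonneg fun _ _ => abs_nonneg _
  let I : LinearMap.BilinForm ℝ (EuclideanSpace ℝ (Fin N)) := innerₗ _
  have hI : ∀ x, I x x = ‖x‖ ^ 2 := fun x => real_inner_self_eq_norm_sq x
  have hIs : ∀ x y, I x y = I y x := fun x y => real_inner_comm y x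
  have hW := nonneg_add_of_nonneg_sparse (B - (15 / 16 : ℝ) • I)
    (fun x y => by
      simp only [LinearMap.sub_apply, LinearMap.smul_apply, hsymm x y, hIs x y])
    (m := 3 * d) (by omega) (K := 1 / 8)
    (fun v hv => by
      have h1 := (abs_le.1 (hB v hv)).1
      simp only [LinearMap.sub_apply, LinearMap.smul_apply, hI, smul_eq_mul]
      linarith)
    (fun i => by
      have h1 : sparsity (EuclideanSpace.single i (1 : ℝ)) ≤ 1 := by
        simpa [sparsity_zero] using sparsity_add_single_le 0 i (1 : ℝ)
      have h2 := (abs_le.1 (hB _ (h1.trans (by omega : 1 ≤ 3 * d)))).2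
      simp only [LinearMap.sub_apply, LinearMap.smul_apply, hI, smul_eq_mul]
      simp only [PiLp.norm_single, norm_one] at h2 ⊢
      linarith) u
  simp only [LinearMap.sub_apply, LinearMap.smul_apply, hI, smul_eq_mul] at hW
  have hl2 : l1Norm u ^ 2 ≤ 4 * d * ‖u‖ ^ 2 := by
    have hmu' : (sparsity mu : ℝ) ≤ d := by exact_mod_cast hmu
    calc l1Norm u ^ 2 ≤ (2 * s * ‖u‖) ^ 2 := by gcongr
      _ = 4 * sparsity mu * ‖u‖ ^ 2 := by rw [← hs2]; ring
      _ ≤ _ := by gcongr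
  have hlower : 1 / 2 * ‖u‖ ^ 2 ≤ B u u := by
    have hd' : (1 : ℝ) ≤ d := by exact_mod_cast hd
    push_cast at hW
    have h1 : 0 ≤ (3 * (d : ℝ) - 1) * (B u u - 15 / 16 * ‖u‖ ^ 2) + d / 2 * ‖u‖ ^ 2 := by
      linarith
    by_contra! hlt
    have h2 : (3 * (d : ℝ) - 1) * (B u u - 15 / 16 * ‖u‖ ^ 2) <
        (3 * (d : ℝ) - 1) * (-(7 / 16 * ‖u‖ ^ 2)) :=
      mul_lt_mul_of_pos_left (by linarith) (by linarith)
    nlinarith [sq_nonneg ‖u‖, mul_nonneg (sub_nonneg.2 hd') (sq_nonneg ‖u‖)]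
  have hupper : B u u ≤ 2 * ε * l1Norm u := by
    have h1 : u = ∑ k, u k • EuclideanSpace.single k (1 : ℝ) := by
      ext j
      simp [Pi.single_apply]
    have h2 : B u u = ∑ k, u k * B u (EuclideanSpace.single k 1) := by
      calc B u u = B u (∑ k, u k • EuclideanSpace.single k (1 : ℝ)) := congrArg (B u) h1
        _ = _ := by rw [map_sum]; simp
    rw [h2, l1Norm, Finset.mul_sum]
    refine Finset.sum_le_sum fun k _ => ?_
    calc _ ≤ |u k * B u (EuclideanSpace.single k 1)| := le_abs_self _
      _ = |u k| * |B u (EuclideanSpace.single k 1)| := abs_mul _ _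
      _ ≤ |u k| * (2 * ε) := by gcongr; exact hcorr k
      _ = _ := by ring
  have hfin : ‖u‖ * ‖u‖ ≤ ‖u‖ * (8 * s * ε) := by nlinarith
  rcases (norm_nonneg u).eq_or_lt with h0 | h0
  · rw [← h0]; positivity
  · exact le_of_mul_le_mul_left hfin h0

end Deterministic

/-! ### The empirical and the population second moment forms -/

section Forms

variable {S : Type*} {N n : ℕ}

/-- Evaluation of `f_λ` at a point, as a linear functional of `λ`. -/
def dictEval (h : Fin N → S → ℝ) (s : S) : EuclideanSpace ℝ (Fin N) →ₗ[ℝ] ℝ where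
  toFun lam := dictFun h lam s
  map_add' x y := by simp [dictFun, add_mul, Finset.sum_add_distrib]
  map_smul' c x := by simp [dictFun, Finset.mul_sum, mul_assoc]

theorem dictEval_apply (h : Fin N → S → ℝ) (s : S) (lam : EuclideanSpace ℝ (Fin N)) :
    dictEval h s lam = dictFun h lam s := rfl

theorem dictFun_single (h : Fin N → S → ℝ) (k : Fin N) :
    dictFun h (EuclideanSpace.single k 1) = h k := by
  ext s
  simp [dictFun]

/-- The empirical second moment form `(u, v) ↦ n⁻¹ ∑ j, f_u (x j) * f_v (x j)`. -/
noncomputable def empForm (h : Fin N → S → ℝ) (x : Fin n → S) :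
    LinearMap.BilinForm ℝ (EuclideanSpace ℝ (Fin N)) :=
  LinearMap.mk₂ ℝ (fun u v => (n : ℝ)⁻¹ * ∑ j, dictEval h (x j) u * dictEval h (x j) v)
    (fun u u' v => by simp only [map_add, add_mul, Finset.sum_add_distrib, mul_add])
    (fun c u v => by
      simp only [map_smul, smul_eq_mul, Finset.mul_sum]
      exact Finset.sum_congr rfl fun _ _ => by ring)
    (fun u v v' => by simp only [map_add, mul_add, Finset.sum_add_distrib])
    (fun c u v => by
      simp only [map_smul, smul_eq_mul, Finset.mul_sum]
      exact Finset.sum_congr rfl fun _ _ => by ring)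

theorem empForm_apply (h : Fin N → S → ℝ) (x : Fin n → S) (u v : EuclideanSpace ℝ (Fin N)) :
    empForm h x u v = (n : ℝ)⁻¹ * ∑ j, dictFun h u (x j) * dictFun h v (x j) := rfl

theorem empForm_comm (h : Fin N → S → ℝ) (x : Fin n → S) (u v : EuclideanSpace ℝ (Fin N)) :
    empForm h x u v = empForm h x v u := by
  simp only [empForm_apply, mul_comm]

/-- The Dantzig selector constraints of two vectors bound their empirical correlations with the
dictionary. -/
theorem abs_empForm_sub_single_le {h : Fin N → S → ℝ} {ε : ℝ} {x : Fin n → S} {y : Fin n → ℝ}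
    {lam mu : EuclideanSpace ℝ (Fin N)} (hlam : lam ∈ constraintSet h ε x y)
    (hmu : mu ∈ constraintSet h ε x y) (k : Fin N) :
    |empForm h x (lam - mu) (EuclideanSpace.single k 1)| ≤ 2 * ε := by
  have h1 : empForm h x (lam - mu) (EuclideanSpace.single k 1) =
      (n : ℝ)⁻¹ * ∑ j, (dictFun h lam (x j) - y j) * h k (x j) -
        (n : ℝ)⁻¹ * ∑ j, (dictFun h mu (x j) - y j) * h k (x j) := by
    rw [empForm_apply, dictFun_single, ← mul_sub, ← Finset.sum_sub_distrib]
    congr 1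
    refine Finset.sum_congr rfl fun j _ => ?_
    rw [← dictEval_apply h (x j) (lam - mu), map_sub, dictEval_apply, dictEval_apply]
    ring
  rw [h1]
  exact (abs_sub _ _).trans (by linarith [hlam k, hmu k])

variable [MeasurableSpace S] {Pi : Measure S}

theorem measurable_dictFun {h : Fin N → S → ℝ} (hmeas : ∀ k, Measurable (h k))
    (lam : EuclideanSpace ℝ (Fin N)) : Measurable (dictFun h lam) := by
  unfold dictFun
  fun_prop

theorem memLp_dictFun {h : Fin N → S → ℝ} (hL2 : ∀ k, MemLp (h k) 2 Pi)
    (lam : EuclideanSpace ℝ (Fin N)) : MemLp (dictFun h lam) 2 Pi :=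
  memLp_finsetSum _ fun k _ => (hL2 k).const_mul (lam k)

/-- The population second moment form `(u, v) ↦ ∫ f_u * f_v ∂Π`. -/
noncomputable def popForm (h : Fin N → S → ℝ) (hL2 : ∀ k, MemLp (h k) 2 Pi) :
    LinearMap.BilinForm ℝ (EuclideanSpace ℝ (Fin N)) :=
  have hint : ∀ u v, Integrable (fun s => dictEval h s u * dictEval h s v) Pi := fun u v =>
    (memLp_dictFun hL2 u).integrable_mul (memLp_dictFun hL2 v)
  LinearMap.mk₂ ℝ (fun u v => ∫ s, dictEval h s u * dictEval h s v ∂Pi)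
    (fun u u' v => by
      simp only [map_add, add_mul]
      exact integral_add (hint u v) (hint u' v))
    (fun c u v => by
      simp only [map_smul, smul_eq_mul, mul_assoc]
      exact integral_const_mul c _)
    (fun u v v' => by
      simp only [map_add, mul_add]
      exact integral_add (hint u v) (hint u v'))
    (fun c u v => by
      simp only [map_smul, smul_eq_mul, mul_left_comm _ c]
      exact integral_const_mul c _)

theorem popForm_apply (h : Fin N → S → ℝ) (hL2 : ∀ k, MemLp (h k) 2 Pi)
    (u v : EuclideanSpace ℝ (Fin N)) :
    popForm h hL2 u v = ∫ s, dictFun h u s * dictFun h v s ∂Pi := rfl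

theorem popForm_comm (h : Fin N → S → ℝ) (hL2 : ∀ k, MemLp (h k) 2 Pi)
    (u v : EuclideanSpace ℝ (Fin N)) : popForm h hL2 u v = popForm h hL2 v u := by
  simp only [popForm_apply, mul_comm]

theorem lpNorm_two_sq {f : S → ℝ} (hf : MemLp f 2 Pi) : lpNorm f 2 Pi ^ 2 = ∫ s, f s * f s ∂Pi := by
  rw [lpNorm_eq_integral_norm_rpow_toReal (by norm_num) (by norm_num) hf.1]
  have h0 : 0 ≤ ∫ s, ‖f s‖ ^ (2 : ENNReal).toReal ∂Pi := integral_nonneg fun s => by positivity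
  rw [← Real.rpow_natCast, ← Real.rpow_mul h0]
  simp [← sq]

theorem popForm_self (h : Fin N → S → ℝ) (hL2 : ∀ k, MemLp (h k) 2 Pi)
    (u : EuclideanSpace ℝ (Fin N)) : popForm h hL2 u u = lpNorm (dictFun h u) 2 Pi ^ 2 := by
  rw [popForm_apply, lpNorm_two_sq (memLp_dictFun hL2 u)]

theorem lpNorm_dictFun_le {h : Fin N → S → ℝ} (hL2 : ∀ k, MemLp (h k) 2 Pi)
    (u : EuclideanSpace ℝ (Fin N)) :
    lpNorm (dictFun h u) 2 Pi ≤ √(∑ k, lpNorm (h k) 2 Pi ^ 2) * ‖u‖ := by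
  refine (abs_le_of_sq_le_sq' ?_ (by positivity)).2
  rw [mul_pow, Real.sq_sqrt (Finset.sum_nonneg fun _ _ => sq_nonneg _),
    lpNorm_two_sq (memLp_dictFun hL2 u)]
  have hint : ∀ k, Integrable (fun s => h k s * h k s) Pi := fun k =>
    (hL2 k).integrable_mul (hL2 k)
  simp only [lpNorm_two_sq (hL2 _)]
  rw [← integral_finsetSum _ fun k _ => hint k, ← integral_mul_const]
  refine integral_mono ((memLp_dictFun hL2 u).integrable_mul (memLp_dictFun hL2 u))
    ((integrable_finsetSum _ fun k _ => hint k).mul_const _) fun s => ?_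
  have := Finset.sum_mul_sq_le_sq_mul_sq Finset.univ (fun k => u k) (fun k => h k s)
  simp only [dictFun, EuclideanSpace.norm_sq_eq, Real.norm_eq_abs, sq_abs, ← sq]
  linarith

/-- The set whose infimum is the restricted isometry constant is nonempty, so that a small constant
is a genuine restricted isometry. -/
theorem abs_popForm_sub_le_of_ripConst_le {h : Fin N → S → ℝ} (hL2 : ∀ k, MemLp (h k) 2 Pi)
    {d : ℕ} (hd : ripConst Pi h d ≤ 1 / 100) {u : EuclideanSpace ℝ (Fin N)}
    (hu : sparsity u ≤ d) : |popForm h hL2 u u - ‖u‖ ^ 2| ≤ 101 / 2500 * ‖u‖ ^ 2 := by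
  have hne : {δ : ℝ | 0 < δ ∧ ∀ lam : EuclideanSpace ℝ (Fin N), sparsity lam ≤ d →
      (1 - δ) * ‖lam‖ ≤ lpNorm (dictFun h lam) 2 Pi ∧
        lpNorm (dictFun h lam) 2 Pi ≤ (1 + δ) * ‖lam‖}.Nonempty := by
    refine ⟨1 + √(∑ k, lpNorm (h k) 2 Pi ^ 2), by positivity, fun lam _ => ⟨?_, ?_⟩⟩
    · refine le_trans ?_ lpNorm_nonneg
      nlinarith [norm_nonneg lam, Real.sqrt_nonneg (∑ k, lpNorm (h k) 2 Pi ^ 2)]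
    · refine (lpNorm_dictFun_le hL2 lam).trans ?_
      nlinarith [norm_nonneg lam]
  obtain ⟨δ, ⟨hδ0, hδ⟩, hδ1⟩ := exists_lt_of_csInf_lt hne
    (lt_of_le_of_lt hd (by norm_num : (1 / 100 : ℝ) < 1 / 50))
  obtain ⟨h1, h2⟩ := hδ u hu
  have hu0 := norm_nonneg u
  have hl0 : 0 ≤ lpNorm (dictFun h u) 2 Pi := lpNorm_nonneg
  have h3 : 49 / 50 * ‖u‖ ≤ lpNorm (dictFun h u) 2 Pi := by nlinarith
  have h4 : lpNorm (dictFun h u) 2 Pi ≤ 51 / 50 * ‖u‖ := by nlinarith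
  rw [popForm_self, abs_le]
  constructor <;> nlinarith

/-- In a centered Gaussian dictionary every `f_λ` is centered normal. -/
theorem hasLaw_dictFun {h : Fin N → S → ℝ}
    (hgauss : HasGaussianLaw (fun s (k : Fin N) => h k s) Pi)
    (hcent : ∀ k, ∫ s, h k s ∂Pi = 0) (hL2 : ∀ k, MemLp (h k) 2 Pi)
    (u : EuclideanSpace ℝ (Fin N)) :
    HasLaw (dictFun h u) (gaussianReal 0 (popForm h hL2 u u).toNNReal) Pi := by
  have : IsProbabilityMeasure Pi := hgauss.isProbabilityMeasure
  have hlin : HasGaussianLaw (dictFun h u) Pi := by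
    have := hgauss.map_fun (∑ k, u k • ContinuousLinearMap.proj (R := ℝ) (φ := fun _ : Fin N => ℝ) k)
    simpa [dictFun, Function.comp_def] using! this
  have hmean : ∫ s, dictFun h u s ∂Pi = 0 := by
    unfold dictFun
    rw [integral_finsetSum _ fun k _ => ((hL2 k).integrable (by norm_num)).const_mul _]
    simp [integral_const_mul, hcent]
  refine ⟨hlin.aemeasurable, ?_⟩
  rw [hlin.map_eq_gaussianReal, hmean, variance_of_integral_eq_zero hlin.aemeasurable hmean,
    popForm_apply]
  simp [sq]

end Forms

/-! ### Counting sparse supports against the sample size -/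

section Numerics

variable {N d : ℕ}

theorem three_le_of_le_div_exp (h : (d : ℝ) ≤ (N : ℝ) / Real.exp 1 - 1) : 3 ≤ N := by
  have h1 : (1 : ℝ) ≤ (N : ℝ) / Real.exp 1 := by
    have : (0 : ℝ) ≤ d := by positivity
    linarith
  rw [one_le_div (Real.exp_pos 1)] at h1
  have h2 : (2 : ℝ) < N := by linarith [Real.exp_one_gt_d9]
  exact_mod_cast h2

theorem one_le_log_of_three_le (hN : 3 ≤ N) : 1 ≤ Real.log N := by
  have hN' : (3 : ℝ) ≤ N := by exact_mod_cast hN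
  rw [Real.le_log_iff_exp_le (by linarith)]
  linarith [Real.exp_one_lt_d9]

theorem one_le_log_div (hd : 1 ≤ d) (h : (d : ℝ) ≤ (N : ℝ) / Real.exp 1 - 1) :
    1 ≤ Real.log ((N : ℝ) / d) := by
  have hd' : (1 : ℝ) ≤ d := by exact_mod_cast hd
  have hN : (3 : ℝ) ≤ N := by exact_mod_cast three_le_of_le_div_exp h
  rw [Real.le_log_iff_exp_le (by positivity), le_div_iff₀ (by linarith)]
  have h1 : (d : ℝ) ≤ N / Real.exp 1 := by linarith
  rw [le_div_iff₀ (Real.exp_pos 1)] at h1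
  linarith

theorem log_le_mul_log_div (hd : 1 ≤ d) (h : (d : ℝ) ≤ (N : ℝ) / Real.exp 1 - 1) :
    Real.log N ≤ d * Real.log ((N : ℝ) / d) := by
  have hd' : (1 : ℝ) ≤ d := by exact_mod_cast hd
  have hN : (3 : ℝ) ≤ N := by exact_mod_cast three_le_of_le_div_exp h
  have h1 := one_le_log_div hd h
  have h2 := Real.log_le_sub_one_of_pos (show (0 : ℝ) < d by linarith)
  rw [Real.log_div (by linarith) (by linarith)] at h1 ⊢
  nlinarith

/-- The logarithm of the number of supports of size at most `3 d`, multiplied by the number of net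
points per support, is of order `d log (N / d)`. -/
theorem card_mul_le_exp (hd : 1 ≤ d) (h : (d : ℝ) ≤ (N : ℝ) / Real.exp 1 - 1) :
    ((Finset.univ.filter fun J : Finset (Fin N) => J.card ≤ 3 * d).card : ℝ) *
      (2 * 25 ^ (3 * d)) ≤ 2 * Real.exp (16 * (d * Real.log ((N : ℝ) / d))) := by
  have hd' : (1 : ℝ) ≤ d := by exact_mod_cast hd
  have hN : (3 : ℝ) ≤ N := by exact_mod_cast three_le_of_le_div_exp h
  have h1 := one_le_log_div hd h
  have hdN : (d : ℝ) ≤ N := by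
    refine h.trans ?_
    have : (N : ℝ) / Real.exp 1 ≤ N := div_le_self (by linarith) (by linarith [Real.exp_one_gt_d9])
    linarith
  have hcard := card_filter_card_le (N := N) (q := (d : ℝ) / N) (by positivity)
    (div_le_one_of_le₀ hdN (by linarith)) (3 * d)
  set l := Real.log ((N : ℝ) / d) with hl
  have h2 : (((d : ℝ) / N)⁻¹) ^ (3 * d) = Real.exp (3 * (d * l)) := by
    rw [inv_div, ← Real.exp_log (show (0 : ℝ) < N / d by positivity), ← hl, ← Real.exp_nat_mul]
    congr 1; push_cast; ring
  have h3 : (1 + (d : ℝ) / N) ^ N ≤ Real.exp (d * l) := by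
    calc (1 + (d : ℝ) / N) ^ N ≤ Real.exp ((d : ℝ) / N) ^ N := by
          gcongr
          linarith [Real.add_one_le_exp ((d : ℝ) / N)]
      _ = Real.exp d := by
          rw [← Real.exp_nat_mul]; congr 1; field_simp
      _ ≤ _ := Real.exp_le_exp.2 (by nlinarith)
  have h4 : (25 : ℝ) ^ (3 * d) ≤ Real.exp (12 * (d * l)) := by
    have h5 : (25 : ℝ) ≤ Real.exp 4 := by
      have : Real.exp 4 = Real.exp 1 ^ 4 := by rw [← Real.exp_nat_mul]; norm_num
      rw [this]
      calc (25 : ℝ) ≤ 2.7 ^ 4 := by norm_num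
        _ ≤ _ := by gcongr; linarith [Real.exp_one_gt_d9]
    calc (25 : ℝ) ^ (3 * d) ≤ Real.exp 4 ^ (3 * d) := by gcongr
      _ = Real.exp (12 * d) := by rw [← Real.exp_nat_mul]; congr 1; push_cast; ring
      _ ≤ _ := Real.exp_le_exp.2 (by nlinarith)
  calc _ ≤ (Real.exp (3 * (d * l)) * Real.exp (d * l)) * (2 * Real.exp (12 * (d * l))) := by
        rw [h2] at hcard
        gcongr
        exact hcard.trans (by gcongr)
    _ = 2 * Real.exp (16 * (d * l)) := by
        rw [← Real.exp_add, mul_left_comm, ← Real.exp_add]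
        congr 2; ring

end Numerics

/-! ### The exceptional events -/

section Events

theorem measureReal_biUnion_le_card_mul {Ω : Type*} [MeasurableSpace Ω] {P : Measure Ω}
    {ι : Type*} (G : Finset ι) (B : ι → Set Ω) {b : ℝ} (hB : ∀ i ∈ G, P.real (B i) ≤ b) :
    P.real (⋃ i ∈ G, B i) ≤ G.card * b := by
  refine (measureReal_biUnion_finset_le G B).trans ?_
  rw [← nsmul_eq_mul]
  exact Finset.sum_le_card_nsmul _ _ _ hB

variable {Ω : Type*} [MeasurableSpace Ω] {P : Measure Ω} [IsProbabilityMeasure P]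
  {S : Type*} [MeasurableSpace S] {Pi : Measure S} {N n : ℕ}

/-- With high probability all empirical correlations of the noise with the dictionary are at most
`ε`. -/
theorem measureReal_noise_le [IsProbabilityMeasure Pi] (hN : 3 ≤ N) (hn : 1 ≤ n)
    {h : Fin N → S → ℝ} (hmeas : ∀ k, Measurable (h k))
    (hgauss : HasGaussianLaw (fun s (k : Fin N) => h k s) Pi)
    (hcent : ∀ k, ∫ s, h k s ∂Pi = 0) (hL2 : ∀ k, MemLp (h k) 2 Pi)
    {X : Fin n → Ω → S} (hXlaw : ∀ j, HasLaw (X j) Pi P) (hXind : iIndepFun X P)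
    {σ : NNReal} {ξ : Fin n → Ω → ℝ} (hξlaw : ∀ j, HasLaw (ξ j) (gaussianReal 0 (σ ^ 2)) P)
    (hξind : iIndepFun ξ P) (hXξ : IndepFun (fun ω j => X j ω) (fun ω j => ξ j ω) P)
    {A : ℝ} (hA : 1 ≤ A) (hAn : A * Real.log N / n ≤ 1) {ε : ℝ}
    (hε : 5000 * σ * (⨆ k, lpNorm (h k) 2 Pi) * √(A * Real.log N / n) ≤ ε) :
    P.real {ω | ∃ k, ε < |(n : ℝ)⁻¹ * ∑ j, h k (X j ω) * ξ j ω|} ≤ (N : ℝ) ^ (-A) / 2 := by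
  set H := ⨆ k, lpNorm (h k) 2 Pi with hH
  have hH0 : 0 ≤ H := Real.iSup_nonneg fun _ => lpNorm_nonneg
  have hkH : ∀ k, lpNorm (h k) 2 Pi ≤ H := fun k =>
    le_ciSup (f := fun k => lpNorm (h k) 2 Pi) (Set.finite_range _).bddAbove k
  have hn' : (0 : ℝ) < n := by exact_mod_cast hn
  have hN' : (3 : ℝ) ≤ N := by exact_mod_cast hN
  have hlog := one_le_log_of_three_le hN
  have hε0 : 0 ≤ ε := le_trans (by positivity) hε
  set v : Fin N → NNReal := fun k =>
    (popForm h hL2 (EuclideanSpace.single k 1) (EuclideanSpace.single k 1)).toNNReal with hv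
  have hvk : ∀ k, (v k : ℝ) = lpNorm (h k) 2 Pi ^ 2 := fun k => by
    rw [hv]
    simp only [popForm_self, dictFun_single]
    exact Real.coe_toNNReal _ (sq_nonneg _)
  have hlawk : ∀ k, HasLaw (h k) (gaussianReal 0 (v k)) Pi := fun k => by
    have := hasLaw_dictFun hgauss hcent hL2 (EuclideanSpace.single k 1)
    rwa [dictFun_single] at this
  set b : ℝ := 2 * Real.exp (-(4 * (A * Real.log N))) with hb
  have hk : ∀ k ∈ (Finset.univ : Finset (Fin N)),
      P.real {ω | ε < |(n : ℝ)⁻¹ * ∑ j, h k (X j ω) * ξ j ω|} ≤ b := by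
    intro k _
    set r := √(A * Real.log N / n) with hr
    have hr0 : 0 ≤ r := Real.sqrt_nonneg _
    have hr2 : r ^ 2 = A * Real.log N / n := Real.sq_sqrt (by positivity)
    have hnr : n * r ^ 2 = A * Real.log N := by rw [hr2]; field_simp
    rcases (mul_nonneg σ.coe_nonneg hH0).eq_or_lt with h0 | h0
    · -- without noise, or with an almost surely vanishing dictionary, `ε` may be zero
      have hzero : ∀ j, ∀ᵐ ω ∂P, h k (X j ω) * ξ j ω = 0 := by
        intro j
        rcases mul_eq_zero.1 h0.symm with hσ | hH'
        · have hσ' : σ = 0 := by exact_mod_cast hσ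
          have h1 := hξlaw j
          rw [hσ', zero_pow two_ne_zero, gaussianReal_zero_var] at h1
          filter_upwards [h1.ae_eq_of_dirac] with ω hω
          rw [hω, mul_zero]
        · have hvk0 : v k = 0 := by
            have h2 : (v k : ℝ) = 0 := by
              have h3 : lpNorm (h k) 2 Pi = 0 :=
                le_antisymm (hH' ▸ hkH k) lpNorm_nonneg
              rw [hvk, h3, zero_pow two_ne_zero]
            exact_mod_cast h2
          have h1 := (hlawk k).fun_comp (hXlaw j)
          rw [hvk0, gaussianReal_zero_var] at h1
          filter_upwards [h1.ae_eq_of_dirac] with ω hω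
          rw [hω, zero_mul]
      have hnull : P {ω | ε < |(n : ℝ)⁻¹ * ∑ j, h k (X j ω) * ξ j ω|} = 0 := by
        rw [measure_eq_zero_iff_ae_notMem]
        filter_upwards [ae_all_iff.2 hzero] with ω hω
        simp [hω, hε0]
      rw [measureReal_def, hnull]
      simp only [ENNReal.toReal_zero]
      positivity
    · have hσ : (σ : ℝ) ≠ 0 := left_ne_zero_of_mul h0.ne'
      have hH' : H ≠ 0 := right_ne_zero_of_mul h0.ne'
      set T : ℝ := (σ * H) ^ 2 with hT
      have h1 : (r / (2 * (σ * H))) ^ 2 * T = r ^ 2 / 4 := by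
        rw [hT]; field_simp; norm_num
      have hmain := measureReal_abs_average_mul_noise_le hn hXlaw hXind hξlaw hξind hXξ
        (hmeas k) (hlawk k) (s := r / (2 * (σ * H))) (T := T) (by positivity)
        (by
          rw [hvk, hT, mul_pow]
          push_cast
          gcongr
          · exact lpNorm_nonneg
          · exact hkH k)
        (by
          rw [h1, hr2]
          linarith) ε
      have hsub : {ω | ε < |(n : ℝ)⁻¹ * ∑ j, h k (X j ω) * ξ j ω|} ⊆
          {ω | ε ≤ |(n : ℝ)⁻¹ * ∑ j, h k (X j ω) * ξ j ω|} :=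
        Set.ofPred_subset_ofPred.2 fun ω hω => hω.le
      refine (measureReal_mono hsub).trans (hmain.trans ?_)
      rw [hb]
      gcongr
      have h2 : 2500 * r ^ 2 ≤ r / (2 * (σ * H)) * ε := by
        calc 2500 * r ^ 2 = r / (2 * (σ * H)) * (5000 * σ * H * r) := by
              field_simp
              ring
          _ ≤ _ := by gcongr
      have h3 : (n : ℝ) * ((r / (2 * (σ * H))) ^ 2 * T - r / (2 * (σ * H)) * ε) ≤
          n * (-(4 * r ^ 2)) := by
        gcongr
        nlinarith [sq_nonneg r]
      linarith
  have hset : {ω | ∃ k, ε < |(n : ℝ)⁻¹ * ∑ j, h k (X j ω) * ξ j ω|} =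
      ⋃ k ∈ (Finset.univ : Finset (Fin N)),
        {ω | ε < |(n : ℝ)⁻¹ * ∑ j, h k (X j ω) * ξ j ω|} := by
    ext ω; simp
  rw [hset]
  refine (measureReal_biUnion_le_card_mul _ _ hk).trans ?_
  rw [Finset.card_univ, Fintype.card_fin, hb, Real.rpow_def_of_pos (by linarith)]
  have h1 : Real.exp (-(4 * (A * Real.log N))) ≤
      Real.exp (Real.log N * -A) * (Real.exp (-Real.log N)) ^ 3 := by
    rw [← Real.exp_nat_mul, ← Real.exp_add]
    refine Real.exp_le_exp.2 ?_
    push_cast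
    nlinarith
  have h2 : Real.exp (-Real.log N) = (N : ℝ)⁻¹ := by
    rw [Real.exp_neg, Real.exp_log (by linarith)]
  rw [h2] at h1
  have h3 : (N : ℝ) * (2 * ((N : ℝ)⁻¹) ^ 3) ≤ 1 / 2 := by
    have : (N : ℝ) * (2 * ((N : ℝ)⁻¹) ^ 3) = 2 / N ^ 2 := by field_simp
    rw [this, div_le_iff₀ (by positivity)]
    nlinarith
  calc (N : ℝ) * (2 * Real.exp (-(4 * (A * Real.log N))))
      ≤ N * (2 * (Real.exp (Real.log N * -A) * ((N : ℝ)⁻¹) ^ 3)) := by gcongr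
    _ = Real.exp (Real.log N * -A) * (N * (2 * ((N : ℝ)⁻¹) ^ 3)) := by ring
    _ ≤ Real.exp (Real.log N * -A) * (1 / 2) := by gcongr
    _ = _ := by ring

/-- With high probability the empirical second moment form is a restricted isometry. -/
theorem measureReal_not_restricted_isometry_le {d : ℕ} (hd : 1 ≤ d)
    (hdN : (d : ℝ) ≤ (N : ℝ) / Real.exp 1 - 1) (hn : 1 ≤ n)
    {h : Fin N → S → ℝ} (hmeas : ∀ k, Measurable (h k))
    (hgauss : HasGaussianLaw (fun s (k : Fin N) => h k s) Pi)
    (hcent : ∀ k, ∫ s, h k s ∂Pi = 0) (hL2 : ∀ k, MemLp (h k) 2 Pi)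
    (hrip : ripConst Pi h (3 * d) ≤ 1 / 100)
    {X : Fin n → Ω → S} (hXlaw : ∀ j, HasLaw (X j) Pi P) (hXind : iIndepFun X P)
    {A : ℝ} (hA : 1 ≤ A)
    (hAn : 400000000 * (A * (d * Real.log ((N : ℝ) / d))) ≤ n) :
    P.real {ω | ∃ u : EuclideanSpace ℝ (Fin N), sparsity u ≤ 3 * d ∧
      1 / 16 * ‖u‖ ^ 2 < |empForm h (fun j => X j ω) u u - ‖u‖ ^ 2|} ≤ (N : ℝ) ^ (-A) / 2 := by
  have hN' : (3 : ℝ) ≤ N := by exact_mod_cast three_le_of_le_div_exp hdN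
  have hn' : (0 : ℝ) < n := by exact_mod_cast hn
  have hd' : (1 : ℝ) ≤ d := by exact_mod_cast hd
  have hL1 : 1 ≤ d * Real.log ((N : ℝ) / d) := by
    nlinarith [one_le_log_div hd hdN]
  have hLN := log_le_mul_log_div hd hdN
  have hcard := card_mul_le_exp hd hdN
  set L := d * Real.log ((N : ℝ) / d) with hL
  obtain ⟨G, hGcard, hG, hGnet⟩ := exists_sparse_net N (3 * d)
  set v : EuclideanSpace ℝ (Fin N) → NNReal := fun w => (popForm h hL2 w w).toNNReal with hv
  have hvw : ∀ w, (v w : ℝ) = popForm h hL2 w w := fun w => by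
    rw [hv]
    refine Real.coe_toNNReal _ ?_
    rw [popForm_self]
    positivity
  have hdev : ∀ ω w, (empForm h (fun j => X j ω) - popForm h hL2) w w =
      (n : ℝ)⁻¹ * ∑ j, (dictFun h w (X j ω) ^ 2 - v w) := by
    intro ω w
    rw [Finset.sum_sub_distrib, Finset.sum_const, Finset.card_univ, Fintype.card_fin,
      nsmul_eq_mul, mul_sub, inv_mul_cancel_left₀ hn'.ne', hvw]
    simp only [LinearMap.sub_apply, empForm_apply, sq]
  set b : ℝ := 2 * Real.exp (-(100 * (A * L))) with hb
  have hbad : ∀ w ∈ G, P.real {ω | 1 / 500 * 17 ≤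
      |(n : ℝ)⁻¹ * ∑ j, (dictFun h w (X j ω) ^ 2 - v w)|} ≤ b := by
    intro w hw
    -- `17` exceeds `‖w‖ ^ 2 * (1 + 101 / 2500)`, the population second moment at a net point; the
    -- deviation `17 / 500` leaves, after halving, less than `1 / 16 - 101 / 2500` on sparse vectors
    have hw17 : (v w : ℝ) ≤ 17 := by
      have h1 := (abs_le.1 (abs_popForm_sub_le_of_ripConst_le hL2 hrip (hG w hw).1)).2
      have h2 : ‖w‖ ^ 2 ≤ 4 ^ 2 := by
        have := (hG w hw).2
        gcongr
      rw [hvw]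
      linarith
    refine (measureReal_abs_average_sq_sub_le hn hXlaw hXind (measurable_dictFun hmeas w)
      (hasLaw_dictFun hgauss hcent hL2 w) (V := 17) (t := 1 / 500) (by norm_num) hw17
      (by norm_num) (by norm_num)).trans ?_
    rw [hb]
    gcongr
    linarith
  have hsub : {ω | ∃ u : EuclideanSpace ℝ (Fin N), sparsity u ≤ 3 * d ∧
      1 / 16 * ‖u‖ ^ 2 < |empForm h (fun j => X j ω) u u - ‖u‖ ^ 2|} ⊆
      ⋃ w ∈ G, {ω | 1 / 500 * 17 ≤ |(n : ℝ)⁻¹ * ∑ j, (dictFun h w (X j ω) ^ 2 - v w)|} := by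
    rintro ω ⟨u, hu, hlt⟩
    by_contra hω
    simp only [Set.mem_iUnion, Set.mem_ofPred_eq, not_exists, not_le] at hω
    have h1 := hGnet (empForm h (fun j => X j ω) - popForm h hL2)
      (fun x y => by
        simp only [LinearMap.sub_apply, empForm_comm h _ x y, popForm_comm h hL2 x y])
      (1 / 500 * 17) (by norm_num) (fun w hw => by rw [hdev]; exact (hω w hw).le) u hu
    have h2 := abs_popForm_sub_le_of_ripConst_le hL2 hrip hu
    rw [LinearMap.sub_apply, LinearMap.sub_apply] at h1
    have h3 := abs_sub_le (empForm h (fun j => X j ω) u u) (popForm h hL2 u u) (‖u‖ ^ 2)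
    nlinarith [sq_nonneg ‖u‖]
  refine (measureReal_mono hsub (measure_ne_top P _)).trans
    ((measureReal_biUnion_le_card_mul G _ hbad).trans ?_)
  have hGcard' : (G.card : ℝ) ≤ 2 * Real.exp (16 * L) := by
    refine le_trans ?_ hcard
    exact_mod_cast hGcard
  have h8 : (8 : ℝ) ≤ Real.exp (3 * L) := by
    have : Real.exp 3 = Real.exp 1 ^ 3 := by rw [← Real.exp_nat_mul]; norm_num
    calc (8 : ℝ) ≤ Real.exp 1 ^ 3 := by
          calc (8 : ℝ) = 2 ^ 3 := by norm_num
            _ ≤ _ := by gcongr; linarith [Real.exp_one_gt_d9]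
      _ = Real.exp 3 := this.symm
      _ ≤ _ := Real.exp_le_exp.2 (by linarith)
  rw [Real.rpow_def_of_pos (by linarith)]
  calc (G.card : ℝ) * b ≤ 2 * Real.exp (16 * L) * b := by gcongr
    _ = 8 * Real.exp (16 * L - 100 * (A * L)) / 2 := by
        rw [hb, sub_eq_add_neg, Real.exp_add]; ring
    _ ≤ Real.exp (3 * L) * Real.exp (16 * L - 100 * (A * L)) / 2 := by gcongr
    _ = Real.exp (3 * L + (16 * L - 100 * (A * L))) / 2 := by rw [Real.exp_add (3 * L)]
    _ ≤ Real.exp (Real.log N * -A) / 2 := by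
        gcongr
        nlinarith

end Events

end Dantzig

theorem proposition1 :
    ∃ δbar C D : ℝ, 0 < δbar ∧ δbar < 1 ∧ 0 < C ∧ 0 < D ∧
      ∀ (Ω : Type*) [MeasurableSpace Ω] (P : Measure Ω) [IsProbabilityMeasure P]
        (S : Type*) [MeasurableSpace S] (Pi : Measure S) [IsProbabilityMeasure Pi]
        (N n : ℕ) (_hN : 2 ≤ N) (_hn : 1 ≤ n)
        -- the dictionary: `(h 1, …, h N)` is a centered Gaussian vector under `Pi`
        (h : Fin N → S → ℝ) (_hmeas : ∀ k, Measurable (h k))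
        (_hgauss : HasGaussianLaw (fun s (k : Fin N) => h k s) Pi)
        (_hcent : ∀ k, ∫ s, h k s ∂Pi = 0)
        -- the regression model: i.i.d. design, i.i.d. normal noise independent of the design
        (X : Fin n → Ω → S) (_hXlaw : ∀ j, HasLaw (X j) Pi P) (_hXind : iIndepFun X P)
        (σ : NNReal) (ξ : Fin n → Ω → ℝ)
        (_hξlaw : ∀ j, HasLaw (ξ j) (gaussianReal 0 (σ ^ 2)) P) (_hξind : iIndepFun ξ P)
        (_hXξ : IndepFun (fun ω j => X j ω) (fun ω j => ξ j ω) P)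
        (fstar : S → ℝ) (Y : Fin n → Ω → ℝ) (_hY : ∀ j ω, Y j ω = fstar (X j ω) + ξ j ω)
        (lamstar : EuclideanSpace ℝ (Fin N)) (_hfstar : fstar = Dantzig.dictFun h lamstar)
        (A : ℝ) (_hA : 1 ≤ A) (dbar : ℕ)
        (_hdbar : IsGreatest (Dantzig.admissibleDims Pi h n δbar C A) dbar)
        -- automatic (for large `C`) unless `dbar = 0`
        (_hAn : dbar = 0 → A * Real.log N / n ≤ 1)
        (ε : ℝ)
        (_hε : C * σ * (⨆ k, lpNorm (h k) 2 Pi) * √(A * Real.log N / n) ≤ ε)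
        (_hsparse : Dantzig.sparsity lamstar ≤ dbar)
        (lamhat : Ω → EuclideanSpace ℝ (Fin N))
        (_hlamhat : ∀ ω, Dantzig.IsDantzigSelector h ε (fun j => X j ω) (fun j => Y j ω)
          (lamhat ω)),
        -- `lamhat` need not be measurable, so the bound is claimed on a measurable event
        ∃ E : Set Ω, MeasurableSet E ∧ 1 - (N : ℝ) ^ (-A) ≤ P.real E ∧
          ∀ ω ∈ E, ‖lamhat ω - lamstar‖ ≤ D * √(Dantzig.sparsity lamstar : ℝ) * ε := by
  refine ⟨1 / 100, 5000, 8, by norm_num, by norm_num, by norm_num, by norm_num, ?_⟩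
  intro Ω _ P _ S _ Pi _ N n _ hn h hmeas hgauss hcent X hXlaw hXind σ ξ hξlaw hξind hXξ fstar Y hY
    lamstar hfstar A hA dbar hdbar hAn ε hε hsparse lamhat hlamhat
  obtain ⟨hdN, hrip, hdn⟩ := hdbar.1
  have hL2 : ∀ k, MemLp (h k) 2 Pi := fun k => (hgauss.eval k).memLp_two
  have hn' : (0 : ℝ) < n := by exact_mod_cast hn
  have hN : 3 ≤ N := Dantzig.three_le_of_le_div_exp hdN
  have hlog := Dantzig.one_le_log_of_three_le hN
  have hε0 : 0 ≤ ε := by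
    refine le_trans ?_ hε
    have : 0 ≤ ⨆ k, lpNorm (h k) 2 Pi := Real.iSup_nonneg fun _ => lpNorm_nonneg
    positivity
  -- `400000000 = 16 * 5000 ^ 2`
  have hsample : 1 ≤ dbar → 400000000 * (A * (dbar * Real.log ((N : ℝ) / dbar))) ≤ n := by
    intro hd
    have h0 := Dantzig.one_le_log_div hd hdN
    have h1 : √(A * dbar * Real.log ((N : ℝ) / dbar) / n) ≤ 1 / 20000 := by linarith
    rw [Real.sqrt_le_left (by norm_num), div_le_iff₀ hn'] at h1
    nlinarith
  have hAn' : A * Real.log N / n ≤ 1 := by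
    rcases Nat.eq_zero_or_pos dbar with h0 | h0
    · exact hAn h0
    · rw [div_le_one hn']
      have h1 := Dantzig.log_le_mul_log_div h0 hdN
      have h2 := hsample h0
      nlinarith
  set Bnoise : Set Ω := {ω | ∃ k, ε < |(n : ℝ)⁻¹ * ∑ j, h k (X j ω) * ξ j ω|} with hBnoise
  -- for `dbar = 0` the error vanishes as soon as `lamstar` is feasible, without any isometry
  set Brip : Set Ω := {ω | 1 ≤ dbar ∧ ∃ u : EuclideanSpace ℝ (Fin N),
    Dantzig.sparsity u ≤ 3 * dbar ∧
      1 / 16 * ‖u‖ ^ 2 < |Dantzig.empForm h (fun j => X j ω) u u - ‖u‖ ^ 2|} with hBrip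
  have hPnoise : P.real Bnoise ≤ (N : ℝ) ^ (-A) / 2 :=
    Dantzig.measureReal_noise_le hN hn hmeas hgauss hcent hL2 hXlaw hXind hξlaw hξind hXξ hA hAn'
      hε
  have hPrip : P.real Brip ≤ (N : ℝ) ^ (-A) / 2 := by
    rcases Nat.eq_zero_or_pos dbar with h0 | h0
    · have : Brip = ∅ := by
        ext ω
        simp [hBrip, h0]
      rw [this, measureReal_empty]
      positivity
    · exact (measureReal_mono fun ω hω => hω.2).trans
        (Dantzig.measureReal_not_restricted_isometry_le h0 hdN hn hmeas hgauss hcent hL2 hrip hXlaw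
          hXind hA (hsample h0))
  refine ⟨(toMeasurable P (Bnoise ∪ Brip))ᶜ, (measurableSet_toMeasurable _ _).compl, ?_, ?_⟩
  · rw [probReal_compl_eq_one_sub (measurableSet_toMeasurable _ _), measureReal_def,
      measure_toMeasurable, ← measureReal_def]
    linarith [measureReal_union_le (μ := P) Bnoise Brip]
  · intro ω hω
    have hω' : ω ∉ Bnoise ∪ Brip := fun h => hω (subset_toMeasurable _ _ h)
    rw [Set.mem_union, not_or] at hω'
    obtain ⟨hωn, hωr⟩ := hω'
    simp only [hBnoise, Set.mem_ofPred_eq, not_exists, not_lt] at hωn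
    have hfeas : lamstar ∈ Dantzig.constraintSet h ε (fun j => X j ω) (fun j => Y j ω) := by
      intro k
      refine le_trans (le_of_eq ?_) (hωn k)
      rw [← abs_neg, ← mul_neg, ← Finset.sum_neg_distrib]
      congr 2
      refine Finset.sum_congr rfl fun j _ => ?_
      simp only [hY, hfstar]
      ring
    obtain ⟨hhat, hmin⟩ := hlamhat ω ⟨lamstar, hfeas⟩
    have hl1 := hmin lamstar hfeas
    rcases Nat.eq_zero_or_pos dbar with h0 | h0
    · have hs0 : Dantzig.sparsity lamstar = 0 := by omega
      have h1 := Dantzig.l1Norm_sub_le (lamhat ω) lamstar hl1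
      rw [hs0, Nat.cast_zero, Real.sqrt_zero, mul_zero, zero_mul] at h1
      have h2 := Dantzig.eq_zero_of_l1Norm_eq_zero
        (le_antisymm h1 (Finset.sum_nonneg fun _ _ => abs_nonneg _))
      simp [h2, hs0]
    · refine Dantzig.norm_sub_le_of_restricted_isometry (Dantzig.empForm h fun j => X j ω)
        (Dantzig.empForm_comm h _) h0 (fun u hu => ?_) (lamhat ω) lamstar hsparse hl1 hε0
        (fun k => Dantzig.abs_empForm_sub_single_le hhat hfeas k)
      by_contra! hlt
      exact hωr ⟨h0, u, hu, hlt⟩
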